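/- A tree is a partial order $(T,\preceq)$ with a least element such that for every $n\in T$ the set $\{m\in T : m\preceq n\}$ is finite and linearly ordered. It is computable if $T\subseteq\mathbb{N}$ is a computable set and $\preceq$ is a computable relation on $T\times T$. A tree is of type 1 if it has a maximal infinite node, that is, a node $n$ such that $\{m : n\preceq m\}$ is infinite but $\{l : m\preceq l\}$ is finite for every $m\succ n$. A self-embedding of $T$ is an injective map $f:T\to T$ such that $n\preceq m$ if and only if $f(n)\preceq f(m)$, for all $n,m\in T$; it is nontrivial if it is not onto. Lemma. Every computable type 1 tree has a nontrivial self-embedding that is computable in $0'$ (the halting set). -/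

import Mathlib

/-- `le` is the order `⪯` of a tree with underlying set `α`: a partial order with a least element
in which the set of nodes below any given node is finite and linearly ordered. -/
structure IsTree {α : Type*} (le : α → α → Prop) : Prop where
  refl : ∀ n, le n n
  antisymm : ∀ m n, le m n → le n m → m = n
  trans : ∀ l m n, le l m → le m n → le l n
  exists_root : ∃ r, ∀ n, le r n
  finite_below : ∀ n, {m | le m n}.Finite
  linear_below : ∀ n a b, le a n → le b n → le a b ∨ le b a

/-- The node `n` is infinite: the subtree `T(n) = {m | n ⪯ m}` is infinite. -/
def IsInfiniteNode {α : Type*} (le : α → α → Prop) (n : α) : Prop :=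
  {m | le n m}.Infinite

/-- A type 1 tree is one that contains a maximal infinite node: a node `n` such that `T(n)` is
infinite, while `T(m)` is finite for every node `m` strictly above `n`. -/
def IsTypeOne {α : Type*} (le : α → α → Prop) : Prop :=
  ∃ n, IsInfiniteNode le n ∧ ∀ m, le n m → m ≠ n → ¬ IsInfiniteNode le m

/-- `(T, le)` with `T ⊆ ℕ` is computably presented: `T` is a computable set and `le` is a
computable relation on `T × T`. -/
structure IsComputablePresentation (T : Set ℕ) (le : T → T → Prop) : Prop where
  carrier : ComputablePred fun n : ℕ => n ∈ T
  rel : ComputablePred fun p : ℕ × ℕ => ∃ (h₁ : p.1 ∈ T) (h₂ : p.2 ∈ T), le ⟨p.1, h₁⟩ ⟨p.2, h₂⟩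

/-- The halting set `K`: the set of `e` such that the `e`-th partial computable function converges
on input `e`. -/
def haltingSet : Set ℕ :=
  {e | ((Denumerable.ofNat Nat.Partrec.Code e).eval e).Dom}

open Classical in
/-- `0'`, as the characteristic function of the halting set. -/
noncomputable def zeroJump (e : ℕ) : ℕ :=
  if e ∈ haltingSet then 1 else 0

/-- A function `f : T → T` with `T ⊆ ℕ`, regarded as a partial function on `ℕ` with domain `T`. -/
def asPartial {T : Set ℕ} (f : T → T) : ℕ →. ℕ :=
  fun n => ⟨n ∈ T, fun h => (f ⟨n, h⟩ : ℕ)⟩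

/-!
Let `n` be a maximal infinite node. It has infinitely many children (immediate successors), and the
subtree at each of them is finite. By Kruskal's theorem
(`IsTree.partiallyWellOrderedOn_subtreeEmb`), the finite subtrees are well-quasi-ordered by
embeddability; hence all but finitely many children have a subtree that embeds into the subtrees at
infinitely many other children (`IsTree.finite_setOf_finite_subtreeEmb`). Starting beyond the
exceptions, one obtains a chain of children `r 0 < r 1 < ⋯`, increasing as numbers, in which the
subtree at each `r k` embeds into the one at `r (k + 1)`. Shifting the subtrees along the chain and
fixing all other nodes is a self-embedding (`IsTree.le_iff_le_of_shift`) whose range omits `r 0`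
(`IsTree.ne_of_shift`).

For the complexity bound, "`c` is a child of `n`" and "`w` codes an embedding of the subtree at `r`
into the subtree at `c`" are universal statements with a computable matrix, so `0'` decides them and
can search for witnesses (`exists_recursiveIn_zeroJump_search`). Thus `0'` computes both the step
from `r k` to `r (k + 1)`, together with an embedding, and the child of `n` below a given node. As
the chain is increasing, `0'` also decides whether that child belongs to it.
-/

/-! ### Kruskal's theorem for the finite subtrees of a tree -/

/-- The subtree above `x` embeds, as a partial order, into the subtree above `y`. The witness is a
total function, of which only the values above `x` matter. -/
def SubtreeEmb {α : Type*} (le : α → α → Prop) (x y : α) : Prop :=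
  ∃ φ : α → α, (∀ v, le x v → le y (φ v)) ∧
    ∀ v v', le x v → le x v' → (le v v' ↔ le (φ v) (φ v'))

/-- The node `c` is an immediate successor of the node `x`. -/
def IsChild {α : Type*} (le : α → α → Prop) (x c : α) : Prop :=
  le x c ∧ c ≠ x ∧ ∀ z, le x z → le z c → z ≠ x → z = c

namespace IsTree

variable {α : Type*} {le : α → α → Prop}

theorem exists_isChild_le (h : IsTree le) {x v : α} (hv : le x v) (hne : v ≠ x) :
    ∃ c, IsChild le x c ∧ le c v := by
  have hfin : {c | le x c ∧ c ≠ x ∧ le c v}.Finite := (h.finite_below v).subset fun c hc => hc.2.2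
  -- a minimal element is one with the fewest predecessors
  obtain ⟨c, ⟨hxc, hcx, hcv⟩, hmin⟩ := Set.exists_min_image _ (fun c => {m | le m c}.ncard) hfin
    ⟨v, hv, hne, h.refl v⟩
  refine ⟨c, ⟨hxc, hcx, fun z hxz hzc hzx => ?_⟩, hcv⟩
  by_contra hne'
  refine absurd (hmin z ⟨hxz, hzx, h.trans _ _ _ hzc hcv⟩) (not_le.2 ?_)
  refine Set.ncard_lt_ncard ⟨fun m hm => h.trans _ _ _ hm hzc, fun hsub => ?_⟩ (h.finite_below c)
  exact hne' (h.antisymm _ _ hzc (hsub (h.refl c)))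

theorem isChild_unique (h : IsTree le) {x c c' v : α} (hc : IsChild le x c) (hc' : IsChild le x c')
    (hcv : le c v) (hcv' : le c' v) : c = c' := by
  rcases h.linear_below v c c' hcv hcv' with hl | hl
  · exact hc'.2.2 c hc.1 hl hc.2.1
  · exact (hc.2.2 c' hc'.1 hl hc'.2.1).symm

theorem subtreeEmb_refl (x : α) : SubtreeEmb le x x :=
  ⟨id, fun _ hv => hv, fun _ _ _ _ => Iff.rfl⟩

theorem subtreeEmb_trans {x y z : α} (hxy : SubtreeEmb le x y) (hyz : SubtreeEmb le y z) :
    SubtreeEmb le x z := by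
  obtain ⟨φ, hφ, hφ'⟩ := hxy
  obtain ⟨ψ, hψ, hψ'⟩ := hyz
  exact ⟨ψ ∘ φ, fun v hv => hψ _ (hφ v hv), fun v v' hv hv' =>
    (hφ' v v' hv hv').trans (hψ' _ _ (hφ v hv) (hφ v' hv'))⟩

theorem subtreeEmb_of_le (h : IsTree le) {x y : α} (hxy : le y x) : SubtreeEmb le x y :=
  ⟨id, fun _ hv => h.trans _ _ _ hxy hv, fun _ _ _ _ => Iff.rfl⟩

/-- Embeddings of the subtrees at the children of `x` into those at distinct children of `y` are
glued to an embedding of the subtree at `x` into the one at `y`. -/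
theorem subtreeEmb_of_children (h : IsTree le) {x y : α} (g : α → α)
    (hg : ∀ c, IsChild le x c → IsChild le y (g c) ∧ SubtreeEmb le c (g c))
    (hinj : ∀ c c', IsChild le x c → IsChild le x c' → g c = g c' → c = c') :
    SubtreeEmb le x y := by
  classical
  choose! ψ hψ using fun c (hc : IsChild le x c) => (hg c hc).2
  choose! ch hch using fun v (hv : le x v ∧ v ≠ x) => h.exists_isChild_le hv.1 hv.2
  have hmem : ∀ v, le x v → v ≠ x → le (g (ch v)) (ψ (ch v) v) := fun v hv hvx =>
    (hψ _ (hch v ⟨hv, hvx⟩).1).1 v (hch v ⟨hv, hvx⟩).2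
  have hchild : ∀ v, le x v → v ≠ x → IsChild le y (g (ch v)) := fun v hv hvx =>
    (hg _ (hch v ⟨hv, hvx⟩).1).1
  refine ⟨fun v => if v = x then y else ψ (ch v) v, fun v hv => ?_, fun v v' hv hv' => ?_⟩
  · dsimp only
    split_ifs with hvx
    · exact h.refl y
    · exact h.trans _ _ _ (hchild v hv hvx).1 (hmem v hv hvx)
  · dsimp only
    split_ifs with hvx hvx' hvx'
    · subst hvx hvx'
      exact ⟨fun _ => h.refl _, fun _ => h.refl _⟩
    · subst hvx
      exact ⟨fun _ => h.trans _ _ _ (hchild v' hv' hvx').1 (hmem v' hv' hvx'), fun _ => hv'⟩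
    · subst hvx'
      refine ⟨fun hle => absurd (h.antisymm _ _ hle hv) hvx, fun hle => ?_⟩
      exact absurd (h.antisymm _ _ (h.trans _ _ _ (hmem v hv hvx) hle) (hchild v hv hvx).1)
        (hchild v hv hvx).2.1
    · obtain ⟨hc, hcv⟩ := hch v ⟨hv, hvx⟩
      obtain ⟨hc', hcv'⟩ := hch v' ⟨hv', hvx'⟩
      by_cases hcc : ch v = ch v'
      · rw [← hcc] at hcv' ⊢
        exact (hψ _ hc).2 v v' hcv hcv'
      · refine ⟨fun hle => absurd ?_ hcc, fun hle => absurd ?_ hcc⟩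
        · exact h.isChild_unique hc hc' (h.trans _ _ _ hcv hle) hcv'
        · exact hinj _ _ hc hc' (h.isChild_unique (hchild v hv hvx) (hchild v' hv' hvx')
            (h.trans _ _ _ (hmem v hv hvx) hle) (hmem v' hv' hvx'))

theorem subtreeEmb_of_sublistForall₂ (h : IsTree le) {x y : α} {l₁ l₂ : List α}
    (hl₁ : ∀ c, c ∈ l₁ ↔ IsChild le x c) (hl₂ : ∀ c, c ∈ l₂ → IsChild le y c) (hnd : l₂.Nodup)
    (hsub : List.SublistForall₂ (SubtreeEmb le) l₁ l₂) : SubtreeEmb le x y := by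
  classical
  obtain ⟨l, hall, hl⟩ := List.sublistForall₂_iff.1 hsub
  obtain ⟨hlen, hget⟩ := List.forall₂_iff_get.1 hall
  have hidx : ∀ c, IsChild le x c → l₁.idxOf c < l₁.length := fun c hc =>
    List.idxOf_lt_length_of_mem ((hl₁ c).2 hc)
  have hgd : ∀ c (hc : IsChild le x c),
      l.getD (l₁.idxOf c) y = l[l₁.idxOf c]'(hlen ▸ hidx c hc) := fun c hc =>
    List.getD_eq_getElem _ _ _
  refine h.subtreeEmb_of_children (fun c => l.getD (l₁.idxOf c) y) (fun c hc => ⟨?_, ?_⟩)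
    fun c c' hc hc' heq => ?_
  · rw [hgd c hc]
    exact hl₂ _ (hl.subset (List.getElem_mem _))
  · rw [hgd c hc]
    simpa using hget _ (hidx c hc) (hlen ▸ hidx c hc)
  · rw [hgd c hc, hgd c' hc', (hnd.sublist hl).getElem_inj_iff] at heq
    exact (List.idxOf_inj ((hl₁ c).2 hc)).1 heq

/-- **Kruskal's theorem** for the finite subtrees of a tree: they are well-quasi-ordered by
embeddability. In a minimal bad sequence the children of its terms are well-quasi-ordered, so by
Higman's lemma the lists of children are too, and two comparable lists glue to an embedding. -/
theorem partiallyWellOrderedOn_subtreeEmb (h : IsTree le) :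
    {x | {m | le x m}.Finite}.PartiallyWellOrderedOn (SubtreeEmb le) := by
  classical
  have : IsPreorder α (SubtreeEmb le) :=
    { refl := subtreeEmb_refl, trans := fun _ _ _ => subtreeEmb_trans }
  rw [Set.PartiallyWellOrderedOn.iff_not_exists_isMinBadSeq fun x => {m | le x m}.ncard]
  rintro ⟨x, ⟨hxfin, hbad⟩, hmin⟩
  have hcfin : ∀ n c, IsChild le (x n) c → {m | le c m}.Finite := fun n c hc =>
    (hxfin n).subset fun m hm => h.trans _ _ _ hc.1 hm
  have hS : {c | ∃ n, IsChild le (x n) c}.PartiallyWellOrderedOn (SubtreeEmb le) := by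
    rw [Set.PartiallyWellOrderedOn.iff_forall_not_isBadSeq]
    rintro y ⟨hy, hybad⟩
    choose n hn using hy
    obtain ⟨k, hk⟩ : ∃ k, ∀ j, n k ≤ n j := by
      obtain ⟨k, hk⟩ := Nat.find_spec (⟨n 0, 0, rfl⟩ : ∃ N k, n k = N)
      exact ⟨k, fun j => hk ▸ Nat.find_min' _ ⟨j, rfl⟩⟩
    refine hmin (n k) (fun m => if m < n k then x m else y (k + (m - n k)))
      (fun m hm => (if_pos hm).symm) ?_ ⟨fun m => ?_, fun m m' hmm' => ?_⟩
    · simp only [lt_irrefl, if_false, Nat.sub_self, Nat.add_zero]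
      refine Set.ncard_lt_ncard ⟨fun m hm => h.trans _ _ _ (hn k).1 hm, fun hsub => ?_⟩ (hxfin _)
      exact (hn k).2.1 (h.antisymm _ _ (hsub (h.refl _)) (hn k).1)
    · dsimp only
      split_ifs
      · exact hxfin m
      · exact hcfin _ _ (hn _)
    · dsimp only
      split_ifs with h1 h2 h2
      · exact hbad m m' hmm'
      · exact fun hemb => hbad m (n (k + (m' - n k))) (h1.trans_le (hk _))
          (subtreeEmb_trans hemb (h.subtreeEmb_of_le (hn _).1))
      · omega
      · exact hybad _ _ (by omega)
  have hch : ∀ n, {c | IsChild le (x n) c}.Finite := fun n => (hxfin n).subset fun c hc => hc.1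
  obtain ⟨i, j, hij, hsub⟩ :=
    (hS.partiallyWellOrderedOn_sublistForall₂ _).exists_lt
      (f := fun n => (hch n).toFinset.toList) fun n c hc => ⟨n, by simpa using hc⟩
  exact hbad i j hij (h.subtreeEmb_of_sublistForall₂ (by simp) (by simp)
    (Finset.nodup_toList _) hsub)

end IsTree

/-! ### Chains of subtrees above a maximal infinite node -/

namespace IsTree

variable {α : Type*} {le : α → α → Prop}

/-- Above a maximal infinite node `n`, all but finitely many nodes have a subtree that embeds into
the subtrees at infinitely many children of `n`: infinitely many exceptions would include infinitely
many children, and a sequence of those would have no monotone subsequence. -/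
theorem finite_setOf_finite_subtreeEmb (h : IsTree le) {n : α}
    (hmax : ∀ m, le n m → m ≠ n → {l | le m l}.Finite) :
    {x | (le n x ∧ x ≠ n) ∧ {c | IsChild le n c ∧ SubtreeEmb le x c}.Finite}.Finite := by
  have : IsPreorder α (SubtreeEmb le) :=
    { refl := subtreeEmb_refl, trans := fun _ _ _ => subtreeEmb_trans }
  have hB : {c | IsChild le n c ∧ {d | IsChild le n d ∧ SubtreeEmb le c d}.Finite}.Finite := by
    by_contra hinf
    let f := Set.Infinite.natEmbedding _ hinf
    obtain ⟨g, hg⟩ := (h.partiallyWellOrderedOn_subtreeEmb).exists_monotone_subseq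
      (f := fun k => (f k : α)) fun k => hmax _ (f k).2.1.1 (f k).2.1.2.1
    exact Set.infinite_of_injective_forall_mem (f := fun k => (f (g k) : α))
      (fun i j hij => g.injective (f.injective (Subtype.ext hij)))
      (fun k => (⟨(f (g k)).2.1, hg 0 k k.zero_le⟩ :
        (f (g k) : α) ∈ {d | IsChild le n d ∧ SubtreeEmb le (f (g 0)) d})) (f (g 0)).2.2
  refine (hB.biUnion fun c hc => hmax c hc.1.1 hc.1.2.1).subset ?_
  rintro x ⟨⟨hnx, hxn⟩, hx⟩
  obtain ⟨c, hc, hcx⟩ := h.exists_isChild_le hnx hxn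
  exact Set.mem_biUnion (x := c)
    ⟨hc, hx.subset fun d hd => ⟨hd.1, subtreeEmb_trans (h.subtreeEmb_of_le hcx) hd.2⟩⟩ hcx

theorem infinite_setOf_isChild (h : IsTree le) {n : α} (hinf : {m | le n m}.Infinite)
    (hmax : ∀ m, le n m → m ≠ n → {l | le m l}.Finite) : {c | IsChild le n c}.Infinite := by
  intro hfin
  refine hinf (((hfin.biUnion fun c hc => hmax c hc.1 hc.2.1).union (Set.finite_singleton n)).subset
    fun x hx => ?_)
  by_cases hxn : x = n
  · exact Or.inr hxn
  · obtain ⟨c, hc, hcx⟩ := h.exists_isChild_le hx hxn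
    exact Or.inl (Set.mem_biUnion (x := c) hc hcx)

section ShiftAlongChain

variable {n : α} {r : ℕ → α} {f : α → α}

/-- A map that embeds the subtree at each term of a sequence of distinct children of `n` into the
subtree at the next term, and is the identity elsewhere, embeds the whole tree. -/
theorem le_iff_le_of_shift (h : IsTree le) (hr : ∀ k, IsChild le n (r k))
    (hinj : Function.Injective r) (hmem : ∀ k x, le (r k) x → le (r (k + 1)) (f x))
    (hemb : ∀ k x y, le (r k) x → le (r k) y → (le x y ↔ le (f x) (f y)))
    (hid : ∀ x, (∀ k, ¬ le (r k) x) → f x = x) (x y : α) : le x y ↔ le (f x) (f y) := by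
  have hoff : ∀ x y k, (∀ j, ¬ le (r j) x) → le (r k) y → (le x y ↔ le x n) := by
    intro x y k hx hy
    refine ⟨fun hxy => ?_, fun hxn => h.trans _ _ _ hxn (h.trans _ _ _ (hr k).1 hy)⟩
    rcases h.linear_below y x (r k) hxy hy with hxr | hrx
    · rcases h.linear_below (r k) x n hxr (hr k).1 with hxn | hnx
      · exact hxn
      · by_contra hxn
        have hne : x ≠ n := fun he => hxn (he ▸ h.refl _)
        exact hx k ((hr k).2.2 x hnx hxr hne ▸ h.refl _)
    · exact absurd hrx (hx k)
  by_cases hx : ∃ k, le (r k) x <;> by_cases hy : ∃ k, le (r k) y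
  · obtain ⟨k, hk⟩ := hx
    obtain ⟨j, hj⟩ := hy
    by_cases hkj : k = j
    · subst hkj
      exact hemb k x y hk hj
    · refine ⟨fun hle => absurd ?_ hkj, fun hle => absurd ?_ hkj⟩
      · exact hinj (h.isChild_unique (hr k) (hr j) (h.trans _ _ _ hk hle) hj)
      · exact Nat.succ_injective (hinj (h.isChild_unique (hr (k + 1)) (hr (j + 1))
          (h.trans _ _ _ (hmem k x hk) hle) (hmem j y hj)))
  · obtain ⟨k, hk⟩ := hx
    rw [not_exists] at hy
    rw [hid y hy]
    exact ⟨fun hle => absurd (h.trans _ _ _ hk hle) (hy k),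
      fun hle => absurd (h.trans _ _ _ (hmem k x hk) hle) (hy (k + 1))⟩
  · obtain ⟨j, hj⟩ := hy
    rw [not_exists] at hx
    rw [hid x hx, hoff x y j hx hj, hoff x (f y) (j + 1) hx (hmem j y hj)]
  · rw [not_exists] at hx hy
    rw [hid x hx, hid y hy]

theorem ne_of_shift (h : IsTree le) (hr : ∀ k, IsChild le n (r k))
    (hinj : Function.Injective r) (hmem : ∀ k x, le (r k) x → le (r (k + 1)) (f x))
    (hid : ∀ x, (∀ k, ¬ le (r k) x) → f x = x) (x : α) : f x ≠ r 0 := by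
  intro hx
  by_cases hk : ∃ k, le (r k) x
  · obtain ⟨k, hk⟩ := hk
    have hle : le (r (k + 1)) (r 0) := hx ▸ hmem k x hk
    exact absurd (hinj (h.isChild_unique (hr (k + 1)) (hr 0) hle (h.refl _))) k.succ_ne_zero
  · rw [not_exists] at hk
    rw [hid x hk] at hx
    exact hk 0 (hx ▸ h.refl _)

end ShiftAlongChain

end IsTree

/-! ### Computability relative to the halting set -/

namespace ComputablePred

variable {α β : Type*} [Primcodable α] [Primcodable β]

protected theorem comp {p : β → Prop} {f : α → β} (hp : ComputablePred p) (hf : Computable f) :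
    ComputablePred fun a => p (f a) := by
  obtain ⟨_, hp⟩ := hp
  exact ⟨inferInstance, hp.comp hf⟩

protected theorem and {p q : α → Prop} (hp : ComputablePred p) (hq : ComputablePred q) :
    ComputablePred fun a => p a ∧ q a := by
  obtain ⟨_, hp⟩ := hp
  obtain ⟨_, hq⟩ := hq
  exact ⟨inferInstance, (Primrec.and.to_comp.comp hp hq).of_eq fun a => by simp⟩

protected theorem imp {p q : α → Prop} (hp : ComputablePred p) (hq : ComputablePred q) :
    ComputablePred fun a => p a → q a :=
  (hp.and hq.not).not.of_eq fun a => by tauto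

protected theorem iff {p q : α → Prop} (hp : ComputablePred p) (hq : ComputablePred q) :
    ComputablePred fun a => p a ↔ q a :=
  ((hp.imp hq).and (hq.imp hp)).of_eq fun a => by tauto

end ComputablePred

namespace Nat.RecursiveIn

variable {O : Set (ℕ →. ℕ)} {g h : ℕ → ℕ}

theorem comp_some (hg : Nat.RecursiveIn O fun n => Part.some (g n))
    (hh : Nat.RecursiveIn O fun n => Part.some (h n)) :
    Nat.RecursiveIn O fun n => Part.some (g (h n)) :=
  (hg.comp hh).of_eq fun n => by simp

theorem pair_some (hg : Nat.RecursiveIn O fun n => Part.some (g n))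
    (hh : Nat.RecursiveIn O fun n => Part.some (h n)) :
    Nat.RecursiveIn O fun n => Part.some (Nat.pair (g n) (h n)) :=
  (hg.pair hh).of_eq fun n => by simp [Seq.seq]

theorem of_computable (hg : Computable g) : Nat.RecursiveIn O fun n => Part.some (g n) :=
  RecursiveIn.iff_nat.1 hg.computableIn

theorem iterate_some (hg : Nat.RecursiveIn O fun n => Part.some (g n)) (a : ℕ) :
    Nat.RecursiveIn O fun n => Part.some (g^[n] a) := by
  have hsnd : Nat.RecursiveIn O fun n => Part.some n.unpair.2.unpair.2 :=
    of_computable (Computable.snd.comp (Computable.unpair.comp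
      (Computable.snd.comp Computable.unpair)))
  have hprec := (of_computable (O := O) (Computable.const a)).prec (hg.comp_some hsnd)
  have hpair : Nat.RecursiveIn O fun n => Part.some (Nat.pair 0 n) :=
    of_computable (Primrec₂.natPair.to_comp.comp (Computable.const 0) Computable.id)
  refine (hprec.comp hpair).of_eq fun n => ?_
  simp only [Part.bind_eq_bind, Part.bind_some, Nat.unpair_pair]
  induction n with
  | zero => rfl
  | succ n ih => simp [ih, Function.iterate_succ_apply']

/-- Unbounded search for the least zero of a total function. -/
theorem exists_least_zero (hg : Nat.RecursiveIn O fun n => Part.some (g n))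
    (hz : ∀ a, ∃ n, g (Nat.pair a n) = 0) :
    ∃ s : ℕ → ℕ, (Nat.RecursiveIn O fun n => Part.some (s n)) ∧
      (∀ a, g (Nat.pair a (s a)) = 0) ∧ ∀ a, ∀ m < s a, g (Nat.pair a m) ≠ 0 := by
  refine ⟨fun a => Nat.find (hz a),
    hg.rfind.of_eq fun a => Part.eq_some_iff.2 (Nat.mem_rfind.2 ⟨?_, fun {m} hm => ?_⟩),
    fun a => Nat.find_spec (hz a), fun a m hm => Nat.find_min (hz a) hm⟩
  · simpa using Nat.find_spec (hz a)
  · simpa using Nat.find_min (hz a) hm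

end Nat.RecursiveIn

theorem zeroJump_eq_zero {e : ℕ} : zeroJump e = 0 ↔ e ∉ haltingSet := by
  unfold zeroJump
  split_ifs with h <;> simp [h]

/-- `0'` decides universal statements with a computable matrix: a search for a counterexample is a
computation whose halting can be asked for. -/
theorem exists_recursiveIn_zeroJump_forall {p : ℕ × ℕ → Prop} (hp : ComputablePred p) :
    ∃ q : ℕ → ℕ, Nat.RecursiveIn {fun n => Part.some (zeroJump n)} (fun n => Part.some (q n)) ∧
      ∀ n, q n = 0 ↔ ∀ k, p (n, k) := by
  obtain ⟨_, hp⟩ := hp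
  have hF : Partrec fun n : ℕ => Nat.rfind fun k => Part.some (!decide (p (n.unpair.1, k))) := by
    refine Partrec.rfind (Computable.partrec ?_)
    exact Primrec.not.to_comp.comp (hp.comp (Computable.pair
      (Computable.fst.comp (Computable.unpair.comp Computable.fst)) Computable.snd))
  obtain ⟨c, hc⟩ := Nat.Partrec.Code.exists_code.1 (Partrec.nat_iff.1 hF)
  have hcurry : Computable fun n => Encodable.encode (c.curry n) :=
    Computable.encode.comp (Nat.Partrec.Code.primrec₂_curry.to_comp.comp
      (Computable.const c) Computable.id)
  refine ⟨fun n => zeroJump (Encodable.encode (c.curry n)),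
    Nat.RecursiveIn.comp_some (.oracle _ rfl) (.of_computable hcurry), fun n => ?_⟩
  have hmem : Encodable.encode (c.curry n) ∈ haltingSet ↔ ∃ k, ¬ p (n, k) := by
    change ((Denumerable.ofNat Nat.Partrec.Code _).eval _).Dom ↔ _
    rw [Denumerable.ofNat_encode, Nat.Partrec.Code.eval_curry, hc]
    refine Nat.rfind_dom.trans ?_
    simp
  rw [zeroJump_eq_zero, hmem, not_exists_not]

/-- If every `x` has a `w` with `∀ k, p ((x, w), k)`, where `p` is computable, then `0'` computes
such a `w` from `x`. -/
theorem exists_recursiveIn_zeroJump_search {p : (ℕ × ℕ) × ℕ → Prop} (hp : ComputablePred p)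
    (hex : ∀ x, ∃ w, ∀ k, p ((x, w), k)) :
    ∃ s : ℕ → ℕ, Nat.RecursiveIn {fun n => Part.some (zeroJump n)} (fun n => Part.some (s n)) ∧
      ∀ x k, p ((x, s x), k) := by
  obtain ⟨q, hq, hq0⟩ := exists_recursiveIn_zeroJump_forall
    (hp.comp ((Computable.unpair.comp Computable.fst).pair Computable.snd))
  obtain ⟨s, hs, hs0, -⟩ := hq.exists_least_zero fun x => by
    obtain ⟨w, hw⟩ := hex x
    exact ⟨w, (hq0 _).2 (by simpa using hw)⟩
  exact ⟨s, hs, fun x k => by simpa using (hq0 _).1 (hs0 x) k⟩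

/-! ### The order as a relation on natural numbers -/

/-- The order of a tree with underlying set `T ⊆ ℕ` as a relation on `ℕ`, false outside `T`. -/
def natRel {T : Set ℕ} (le : T → T → Prop) (a b : ℕ) : Prop :=
  ∃ (h₁ : a ∈ T) (h₂ : b ∈ T), le ⟨a, h₁⟩ ⟨b, h₂⟩

/-- The function coded by `w`: its values are the entries of the `w`-th finite list of numbers,
followed by zeros. Every finite partial function extends to a function of this form. -/
def codedMap (w v : ℕ) : ℕ :=
  (Denumerable.ofNat (List ℕ) w).getD v 0

theorem exists_codedMap_eq {S : Set ℕ} (hS : S.Finite) (g : ℕ → ℕ) :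
    ∃ w, ∀ v ∈ S, codedMap w v = g v := by
  obtain ⟨n, hn⟩ := hS.bddAbove
  refine ⟨Encodable.encode ((List.range (n + 1)).map g), fun v hv => ?_⟩
  have hlt : v < n + 1 := Nat.lt_succ_of_le (hn hv)
  simp [codedMap, List.getD, List.getElem?_map, List.getElem?_range hlt]

theorem computable_codedMap {α : Type*} [Primcodable α] {f g : α → ℕ} (hf : Computable f)
    (hg : Computable g) : Computable fun a => codedMap (f a) (g a) :=
  (Primrec.list_getD 0).to_comp.comp ((Primrec.ofNat (List ℕ)).to_comp.comp hf) hg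

theorem ComputablePred.eq_nat {α : Type*} [Primcodable α] {f g : α → ℕ} (hf : Computable f)
    (hg : Computable g) : ComputablePred fun a => f a = g a :=
  (Primrec.eq (α := ℕ)).computablePred.comp (hf.pair hg)

theorem ComputablePred.le_nat {α : Type*} [Primcodable α] {f g : α → ℕ} (hf : Computable f)
    (hg : Computable g) : ComputablePred fun a => f a ≤ g a :=
  Primrec.nat_le.computablePred.comp (hf.pair hg)

section

variable {T : Set ℕ} {le : T → T → Prop}

@[simp] theorem natRel_coe {u v : T} : natRel le u v ↔ le u v :=
  ⟨fun ⟨_, _, h⟩ => h, fun h => ⟨u.2, v.2, h⟩⟩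

theorem IsComputablePresentation.natRel_comp (hcomp : IsComputablePresentation T le) {α : Type*}
    [Primcodable α] {f g : α → ℕ} (hf : Computable f) (hg : Computable g) :
    ComputablePred fun a => natRel le (f a) (g a) :=
  hcomp.rel.comp (hf.pair hg)

/-! ### The embedding computed from `0'` -/

/-- `0'` computes, from a node strictly above `n`, the child of `n` below it. -/
theorem exists_recursiveIn_zeroJump_child (hT : IsTree le) (hcomp : IsComputablePresentation T le)
    (n : T) :
    ∃ ρ : ℕ → ℕ, Nat.RecursiveIn {fun n => Part.some (zeroJump n)} (fun x => Part.some (ρ x)) ∧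
      ∀ x : T, le n x → x ≠ n → ∃ c : T, (c : ℕ) = ρ x ∧ IsChild le n c ∧ le c x := by
  let p : (ℕ × ℕ) × ℕ → Prop := fun a =>
    (natRel le n a.1.1 ∧ ¬ a.1.1 = n) →
      (natRel le n a.1.2 ∧ ¬ a.1.2 = n) ∧ natRel le a.1.2 a.1.1 ∧
        (natRel le n a.2 → natRel le a.2 a.1.2 → ¬ a.2 = n → a.2 = a.1.2)
  have hp : ComputablePred p := by
    have h1 : Computable fun a : (ℕ × ℕ) × ℕ => a.1.1 := Computable.fst.comp Computable.fst
    have h2 : Computable fun a : (ℕ × ℕ) × ℕ => a.1.2 := Computable.snd.comp Computable.fst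
    have h3 : Computable fun a : (ℕ × ℕ) × ℕ => a.2 := Computable.snd
    have hn : Computable fun _ : (ℕ × ℕ) × ℕ => (n : ℕ) := Computable.const _
    have hR := @hcomp.natRel_comp
    have hE := @ComputablePred.eq_nat
    exact ((hR hn h1).and (hE h1 hn).not).imp
      (((hR hn h2).and (hE h2 hn).not).and ((hR h2 h1).and
        ((hR hn h3).imp ((hR h3 h2).imp ((hE h3 hn).not.imp (hE h3 h2))))))
  obtain ⟨ρ, hρ, hspec⟩ := exists_recursiveIn_zeroJump_search hp fun x => by
    by_cases hx : natRel le n x ∧ ¬ x = n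
    · obtain ⟨⟨hn, hxT, hnx⟩, hne⟩ := hx
      obtain ⟨c, hc, hcx⟩ := hT.exists_isChild_le hnx fun he => hne (congrArg Subtype.val he)
      refine ⟨c, fun k _ => ⟨⟨natRel_coe.2 hc.1, fun he => hc.2.1 (Subtype.ext he)⟩,
        ⟨c.2, hxT, hcx⟩, ?_⟩⟩
      rintro ⟨_, hk, hnk⟩ ⟨_, _, hkc⟩ hkn
      exact congrArg Subtype.val (hc.2.2 ⟨k, hk⟩ hnk hkc fun he => hkn (congrArg Subtype.val he))
    · exact ⟨0, fun k hx' => absurd hx' hx⟩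
  refine ⟨ρ, hρ, fun x hnx hxn => ?_⟩
  have hs := fun k => hspec x k ⟨natRel_coe.2 hnx, fun he => hxn (Subtype.ext he)⟩
  obtain ⟨⟨⟨_, hc, hnc⟩, hcn⟩, ⟨_, _, hcx⟩, -⟩ := hs 0
  refine ⟨⟨ρ x, hc⟩, rfl, ⟨hnc, fun he => hcn (congrArg Subtype.val he), fun z hnz hzc hzn => ?_⟩,
    hcx⟩
  exact Subtype.ext ((hs z).2.2 (natRel_coe.2 hnz) ⟨z.2, hc, hzc⟩ fun he => hzn (Subtype.ext he))

/-- Above a maximal infinite node `n`, `0'` computes from all but finitely many nodes `r` a larger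
number that is a child of `n` and an embedding of the subtree at `r` into the subtree at it. -/
theorem exists_recursiveIn_zeroJump_next (hT : IsTree le) (hcomp : IsComputablePresentation T le)
    {n : T} (hmax : ∀ m, le n m → m ≠ n → {l | le m l}.Finite) :
    ∃ (b : ℕ) (N : ℕ → ℕ),
      Nat.RecursiveIn {fun n => Part.some (zeroJump n)} (fun r => Part.some (N r)) ∧
      ∀ r : T, b ≤ r → le n r → r ≠ n → ∃ c : T, (c : ℕ) = (N r).unpair.1 ∧ r < c ∧
        IsChild le n c ∧ ∃ φ : T → T,
          (∀ v, le r v → (φ v : ℕ) = codedMap (N r).unpair.2 v ∧ le c (φ v)) ∧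
          ∀ v v', le r v → le r v' → (le v v' ↔ le (φ v) (φ v')) := by
  classical
  obtain ⟨b, hb⟩ := ((hT.finite_setOf_finite_subtreeEmb hmax).image Subtype.val).bddAbove
  -- `a` stands for `((r, w), k)`: the child is the first half of `w`, the second half codes the
  -- embedding, and `k` codes the pair of nodes at which it is tested
  let p : (ℕ × ℕ) × ℕ → Prop := fun a =>
    (b + 1 ≤ a.1.1 ∧ natRel le n a.1.1 ∧ ¬ a.1.1 = n) →
      a.1.1 + 1 ≤ a.1.2.unpair.1 ∧ (natRel le n a.1.2.unpair.1 ∧ ¬ a.1.2.unpair.1 = n) ∧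
      (natRel le n a.2.unpair.1 → natRel le a.2.unpair.1 a.1.2.unpair.1 → ¬ a.2.unpair.1 = n →
        a.2.unpair.1 = a.1.2.unpair.1) ∧
      (natRel le a.1.1 a.2.unpair.1 →
        natRel le a.1.2.unpair.1 (codedMap a.1.2.unpair.2 a.2.unpair.1)) ∧
      (natRel le a.1.1 a.2.unpair.1 → natRel le a.1.1 a.2.unpair.2 →
        (natRel le a.2.unpair.1 a.2.unpair.2 ↔
          natRel le (codedMap a.1.2.unpair.2 a.2.unpair.1)
            (codedMap a.1.2.unpair.2 a.2.unpair.2)))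
  have hp : ComputablePred p := by
    have hr : Computable fun a : (ℕ × ℕ) × ℕ => a.1.1 := Computable.fst.comp Computable.fst
    have hw : Computable fun a : (ℕ × ℕ) × ℕ => a.1.2.unpair :=
      Computable.unpair.comp (Computable.snd.comp Computable.fst)
    have hk : Computable fun a : (ℕ × ℕ) × ℕ => a.2.unpair :=
      Computable.unpair.comp Computable.snd
    have hc := Computable.fst.comp hw
    have hv := Computable.fst.comp hk
    have hv' := Computable.snd.comp hk
    have he := computable_codedMap (Computable.snd.comp hw) hv
    have he' := computable_codedMap (Computable.snd.comp hw) hv'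
    have hn : Computable fun _ : (ℕ × ℕ) × ℕ => (n : ℕ) := Computable.const _
    have hR := @hcomp.natRel_comp
    have hE := @ComputablePred.eq_nat
    exact ((ComputablePred.le_nat (Computable.const _) hr).and
        ((hR hn hr).and (hE hr hn).not)).imp
      ((ComputablePred.le_nat (Computable.succ.comp hr) hc).and
        (((hR hn hc).and (hE hc hn).not).and
          (((hR hn hv).imp ((hR hv hc).imp ((hE hv hn).not.imp (hE hv hc)))).and
            (((hR hr hv).imp (hR hc he)).and
              ((hR hr hv).imp ((hR hr hv').imp ((hR hv hv').iff (hR he he'))))))))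
  obtain ⟨N, hN, hspec⟩ := exists_recursiveIn_zeroJump_search hp fun x => by
    by_cases hx : b + 1 ≤ x ∧ natRel le n x ∧ ¬ x = n
    · obtain ⟨hbx, ⟨hn, hxT, hnx⟩, hne⟩ := hx
      lift x to T using hxT
      have hxn : x ≠ n := fun he => hne (congrArg Subtype.val he)
      have hinf : {c | IsChild le n c ∧ SubtreeEmb le x c}.Infinite := fun hfin =>
        absurd (hb ⟨x, ⟨⟨hnx, hxn⟩, hfin⟩, rfl⟩) (by omega)
      obtain ⟨_, ⟨c, ⟨hc, φ, hφ, hφ'⟩, rfl⟩, hxc⟩ :=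
        (hinf.image Subtype.val_injective.injOn).exists_gt (x : ℕ)
      obtain ⟨w, hw⟩ := exists_codedMap_eq ((hmax x hnx hxn).image Subtype.val)
        fun v => if hv : v ∈ T then φ ⟨v, hv⟩ else 0
      have hw' : ∀ v : T, le x v → codedMap w v = φ v := fun v hv => by
        rw [hw v ⟨v, hv, rfl⟩, dif_pos v.2]
      refine ⟨Nat.pair c w, fun k _ => ?_⟩
      simp only [Nat.unpair_pair]
      refine ⟨hxc, ⟨natRel_coe.2 hc.1, fun he => hc.2.1 (Subtype.ext he)⟩, ?_, ?_, ?_⟩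
      · rintro ⟨_, hk, hnk⟩ ⟨_, _, hkc⟩ hkn
        exact congrArg Subtype.val
          (hc.2.2 ⟨_, hk⟩ hnk hkc fun he => hkn (congrArg Subtype.val he))
      · rintro ⟨_, hv, hxv⟩
        have := hw' ⟨_, hv⟩ hxv
        dsimp only at this
        rw [this]
        exact natRel_coe.2 (hφ _ hxv)
      · rintro ⟨_, hv, hxv⟩ ⟨_, hv', hxv'⟩
        have h1 := hw' ⟨_, hv⟩ hxv
        have h2 := hw' ⟨_, hv'⟩ hxv'
        dsimp only at h1 h2
        rw [h1, h2, natRel_coe, ← hφ' _ _ hxv hxv', ← natRel_coe (le := le)]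
    · exact ⟨0, fun k hx' => absurd hx' hx⟩
  refine ⟨b + 1, N, hN, fun r hbr hnr hrn => ?_⟩
  have hs := fun v v' => hspec r (Nat.pair v v')
    ⟨hbr, natRel_coe.2 hnr, fun he => hrn (Subtype.ext he)⟩
  simp only [Nat.unpair_pair] at hs
  obtain ⟨hrc, ⟨⟨_, hcT, hnc⟩, hcn⟩, -⟩ := hs 0 0
  have hmem : ∀ v : T, le r v → codedMap (N r).unpair.2 v ∈ T := fun v hv =>
    ((hs v 0).2.2.2.1 (natRel_coe.2 hv)).2.1
  have hφ : ∀ v : T, le r v →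
      (((if h : codedMap (N r).unpair.2 v ∈ T then ⟨_, h⟩ else n) : T) : ℕ) =
        codedMap (N r).unpair.2 v := fun v hv => by rw [dif_pos (hmem v hv)]
  refine ⟨⟨_, hcT⟩, rfl, hrc, ⟨hnc, fun he => hcn (congrArg Subtype.val he),
    fun z hnz hzc hzn => ?_⟩,
    fun v => if h : codedMap (N r).unpair.2 v ∈ T then ⟨_, h⟩ else n,
    fun v hv => ⟨hφ v hv, ?_⟩, fun v v' hv hv' => ?_⟩
  · exact Subtype.ext ((hs z 0).2.2.1 (natRel_coe.2 hnz) ⟨z.2, hcT, hzc⟩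
      fun he => hzn (Subtype.ext he))
  · rw [← natRel_coe (le := le), hφ v hv]
    exact (hs v 0).2.2.2.1 (natRel_coe.2 hv)
  · rw [← natRel_coe (le := le), (hs v v').2.2.2.2 (natRel_coe.2 hv) (natRel_coe.2 hv'), ← natRel_coe (le := le),
      hφ v hv, hφ v' hv']

end

theorem lemma2p4 (T : Set ℕ) (le : T → T → Prop) (hT : IsTree le)
    (hcomp : IsComputablePresentation T le) (htype : IsTypeOne le) :
    ∃ f : le ↪r le, ¬ Function.Surjective f ∧
      TuringReducible (asPartial f) (fun n => Part.some (zeroJump n)) := by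
  classical
  obtain ⟨n, hinf, hmax'⟩ := htype
  have hmax : ∀ m, le n m → m ≠ n → {l | le m l}.Finite := fun m hm hne =>
    Set.not_infinite.1 (hmax' m hm hne)
  obtain ⟨ρ, hρ, hρspec⟩ := exists_recursiveIn_zeroJump_child hT hcomp n
  obtain ⟨b, N, hN, hNspec⟩ := exists_recursiveIn_zeroJump_next hT hcomp hmax
  obtain ⟨_, ⟨r₀, hr₀, rfl⟩, hbr₀⟩ :=
    ((hT.infinite_setOf_isChild hinf hmax).image Subtype.val_injective.injOn).exists_gt b
  -- the chain as a sequence of numbers `s`, and of nodes `r`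
  let s : ℕ → ℕ := fun k => (fun r => (N r).unpair.1)^[k] r₀
  have hs : ∀ k, s (k + 1) = (N (s k)).unpair.1 := fun k => Function.iterate_succ_apply' _ _ _
  have hex : ∀ k, ∃ r : T, (r : ℕ) = s k ∧ IsChild le n r ∧ b ≤ r := by
    intro k
    induction k with
    | zero => exact ⟨r₀, rfl, hr₀, hbr₀.le⟩
    | succ k ih =>
      obtain ⟨r, hrs, hr, hbr⟩ := ih
      obtain ⟨c, hcN, hrc, hc, -⟩ := hNspec r hbr hr.1 hr.2.1
      exact ⟨c, by rw [hcN, hs, hrs], hc, hbr.trans hrc.le⟩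
  choose r hrs hr hbr using hex
  have hnext : ∀ k, r k < r (k + 1) ∧ ∃ φ : T → T,
      (∀ v, le (r k) v → (φ v : ℕ) = codedMap (N (r k)).unpair.2 v ∧ le (r (k + 1)) (φ v)) ∧
      ∀ v v', le (r k) v → le (r k) v' → (le v v' ↔ le (φ v) (φ v')) := by
    intro k
    obtain ⟨c, hcN, hrc, -, hφ⟩ := hNspec (r k) (hbr k) (hr k).1 (hr k).2.1
    obtain rfl : c = r (k + 1) := Subtype.ext (by rw [hcN, hrs (k + 1), hs, hrs k])
    exact ⟨hrc, hφ⟩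
  have hmono : StrictMono r := strictMono_nat_of_lt_succ fun k => (hnext k).1
  choose φ hφ hφ' using fun k => (hnext k).2
  have hsmono : StrictMono s := fun i j hij => by
    rw [← hrs, ← hrs]
    exact hmono hij
  have hsrec : Nat.RecursiveIn {fun n => Part.some (zeroJump n)} fun k => Part.some (s k) :=
    ((Nat.RecursiveIn.of_computable (Computable.fst.comp Computable.unpair)).comp_some
      hN).iterate_some _
  -- `κ a` is the least `k` with `a ≤ s k`, found as a zero of the truncated difference `a - s k`
  obtain ⟨κ, hκ, hκ0, hκmin⟩ := Nat.RecursiveIn.exists_least_zero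
    (Nat.RecursiveIn.comp_some
      (Nat.RecursiveIn.of_computable ((Primrec.nat_sub.to_comp).comp
        (Computable.fst.comp Computable.unpair) (Computable.snd.comp Computable.unpair)))
      (Nat.RecursiveIn.pair_some
        (Nat.RecursiveIn.of_computable (Computable.fst.comp Computable.unpair))
        (hsrec.comp_some
          (Nat.RecursiveIn.of_computable (Computable.snd.comp Computable.unpair)))))
    fun a => ⟨a, by simpa using Nat.sub_eq_zero_of_le hsmono.le_apply⟩
  simp only [Nat.unpair_pair] at hκ0 hκmin
  have hκs : ∀ k, κ (s k) = k := fun k => by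
    refine le_antisymm (not_lt.1 fun hlt => hκmin _ k hlt (Nat.sub_self _)) ?_
    exact hsmono.le_iff_le.1 (Nat.sub_eq_zero_iff_le.1 (hκ0 (s k)))
  -- the chain is increasing, so `s (κ a) = a` says that `a` belongs to it
  let F : ℕ → ℕ := fun x =>
    if (natRel le n x ∧ ¬ x = n) ∧ s (κ (ρ x)) = ρ x then codedMap (N (ρ x)).unpair.2 x else x
  have hFon : ∀ k x, le (r k) x → F x = φ k x := by
    intro k x hx
    have hnx : le n x := hT.trans _ _ _ (hr k).1 hx
    have hxn : x ≠ n := by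
      rintro rfl
      exact (hr k).2.1 (hT.antisymm _ _ hx (hr k).1)
    obtain ⟨c, hcρ, hc, hcx⟩ := hρspec x hnx hxn
    obtain rfl := hT.isChild_unique hc (hr k) hcx hx
    have hρs : ρ x = s k := by rw [← hcρ, hrs]
    dsimp only [F]
    rw [if_pos ⟨⟨natRel_coe.2 hnx, fun he => hxn (Subtype.ext he)⟩, by rw [hρs, hκs]⟩,
      (hφ k x hx).1, hcρ]
  have hFoff : ∀ x : T, (∀ k, ¬ le (r k) x) → F x = x := by
    intro x hx
    refine if_neg ?_
    rintro ⟨⟨hnx, hxn⟩, hsρ⟩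
    obtain ⟨c, hcρ, hc, hcx⟩ := hρspec x (natRel_coe.1 hnx) fun he =>
      hxn (congrArg Subtype.val he)
    have : c = r (κ (ρ x)) := Subtype.ext (by rw [hrs, hsρ, hcρ])
    exact hx _ (this ▸ hcx)
  have hFT : ∀ x : T, F x ∈ T := by
    intro x
    by_cases hx : ∃ k, le (r k) x
    · obtain ⟨k, hk⟩ := hx
      rw [hFon k x hk]
      exact (φ k x).2
    · rw [hFoff x (not_exists.1 hx)]
      exact x.2
  let f : T → T := fun x => ⟨F x, hFT x⟩
  have hfon : ∀ k x, le (r k) x → f x = φ k x := fun k x hx => Subtype.ext (hFon k x hx)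
  have hfoff : ∀ x, (∀ k, ¬ le (r k) x) → f x = x := fun x hx => Subtype.ext (hFoff x hx)
  have hmem : ∀ k x, le (r k) x → le (r (k + 1)) (f x) := fun k x hx => by
    rw [hfon k x hx]
    exact (hφ k x hx).2
  have hiff : ∀ x y, le x y ↔ le (f x) (f y) :=
    hT.le_iff_le_of_shift hr hmono.injective hmem
      (fun k x y hx hy => by rw [hfon k x hx, hfon k y hy, hφ' k x y hx hy]) hfoff
  have hinj : Function.Injective f := fun x y hxy =>
    hT.antisymm _ _ ((hiff x y).2 (hxy ▸ hT.refl _)) ((hiff y x).2 (hxy ▸ hT.refl _))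
  refine ⟨⟨⟨f, hinj⟩, (hiff _ _).symm⟩, fun hsurj => ?_, ?_⟩
  · obtain ⟨x, hx⟩ := hsurj (r 0)
    exact hT.ne_of_shift hr hmono.injective hmem hfoff x hx
  · have hFrec : Nat.RecursiveIn {fun n => Part.some (zeroJump n)} fun x => Part.some (F x) := by
      have hid : Nat.RecursiveIn {fun n => Part.some (zeroJump n)} fun x => Part.some (id x) :=
        .of_computable Computable.id
      have h1 : Computable fun a : ℕ => a.unpair.1 := Computable.fst.comp Computable.unpair
      have h2 : Computable fun a : ℕ => a.unpair.2.unpair :=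
        Computable.unpair.comp (Computable.snd.comp Computable.unpair)
      have h3 := Computable.unpair.comp (Computable.snd.comp h2)
      -- `F x` is a computable function of `x`, `ρ x`, `s (κ (ρ x))` and `N (ρ x)`
      have hG : Computable fun a : ℕ =>
          if (natRel le n a.unpair.1 ∧ ¬ a.unpair.1 = n) ∧
            a.unpair.2.unpair.2.unpair.1 = a.unpair.2.unpair.1
          then codedMap a.unpair.2.unpair.2.unpair.2.unpair.2 a.unpair.1 else a.unpair.1 :=
        ComputablePred.ite
          (computable_codedMap (Computable.snd.comp (Computable.unpair.comp
            (Computable.snd.comp h3))) h1) h1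
          (((hcomp.natRel_comp (Computable.const _) h1).and
            (ComputablePred.eq_nat h1 (Computable.const _)).not).and
            (ComputablePred.eq_nat (Computable.fst.comp h3) (Computable.fst.comp h2)))
      refine (Nat.RecursiveIn.comp_some (.of_computable hG) (hid.pair_some (hρ.pair_some
        (((hsrec.comp_some hκ).comp_some hρ).pair_some (hN.comp_some hρ))))).of_eq fun x => ?_
      simp only [Nat.unpair_pair, id]
      rfl
    have hdom : Nat.RecursiveIn {fun n => Part.some (zeroJump n)} fun x =>
        (Part.assert (x ∈ T) fun _ => Part.some ()).map fun _ => x :=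
      Nat.Partrec.recursiveIn (Partrec.nat_iff.1
        (hcomp.carrier.to_re.map Computable.fst.to₂))
    refine RecursiveIn.iff_nat.2 ((hFrec.comp hdom).of_eq fun x => Part.ext fun y => ?_)
    simp only [asPartial, Part.bind_eq_bind, Part.mem_bind_iff, Part.mem_map_iff,
      Part.mem_assert_iff, Part.mem_some_iff, Part.mem_mk_iff]
    constructor
    · rintro ⟨_, ⟨_, ⟨hx, -⟩, rfl⟩, rfl⟩
      exact ⟨hx, rfl⟩
    · rintro ⟨hx, rfl⟩
      exact ⟨x, ⟨(), ⟨hx, trivial⟩, rfl⟩, rfl⟩
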